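/- Let $R$ and $S$ be two-sided Noetherian rings and let $l\colon R\to S$ be a (unital) ring homomorphism. Assume that $S/R$ is a Frobenius extension, i.e. ${}_RS$ is finitely generated projective and ${}_SS_R\cong \mathrm{Hom}_R({}_RS_S,{}_RR_R)$ as $S$-$R$-bimodules, and that ${}_RS_R$ is centrally projective over $R$, i.e. ${}_RS_R$ is isomorphic, as an $R$-$R$-bimodule, to a direct summand of $({}_RR_R)^n$ for some $n\ge 0$. Let $\omega$ be a finitely generated left $R$-module, put $T=\mathrm{End}_R(\omega)$ (acting on $\omega$ from the right), and assume that $\omega$ is Wakamatsu tilting: ${}_R\omega_T$ is a faithful balanced self-orthogonal bimodule, that is, the natural map $R\to \mathrm{End}_{T^{\mathrm{op}}}(\omega)$ is an isomorphism and $\mathrm{Ext}^i_R(\omega,\omega)=0=\mathrm{Ext}^i_{T^{\mathrm{op}}}(\omega,\omega)$ for all $i\ge 1$. For a ring $A$ and a left $A$-module $W$ put $E=\mathrm{End}_A(W)$, acting on $W$ from the right, and $N^W=\mathrm{Hom}_A(N,W)$, a right $E$-module, for a left $A$-module $N$. A finitely generated left $A$-module $N$ has generalized G-dimension zero with respect to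 $W$ if the evaluation map $N\to \mathrm{Hom}_{E^{\mathrm{op}}}(N^W,W)$ is an isomorphism and $\mathrm{Ext}^i_A(N,W)=0=\mathrm{Ext}^i_{E^{\mathrm{op}}}(N^W,W)$ for all $i\ge 1$. Let $\mathrm{G\text{-}dim}_W(N)\in\{0,1,2,\dots,\infty\}$ be the infimum of all $n$ for which there is an exact sequence of $A$-modules $0\to G_n\to\cdots\to G_1\to G_0\to N\to 0$ with every $G_i$ of generalized G-dimension zero with respect to $W$ (and $\infty$ if there is none). Then for every finitely generated left $R$-module $M$, $$\mathrm{G\text{-}dim}_{S\otimes_R\omega}(S\otimes_R M)\le \mathrm{G\text{-}dim}_\omega(M),$$ where the left-hand side is taken over $A=S$, with $W=S\otimes_R\omega$, and the right-hand side over $A=R$, with $W=\omega$. -/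

import Mathlib

universe u

/-- The left `R`-module structure on the extension ring `S` of a ring homomorphism
`l : R →+* S`, namely `r • s = l r * s`. -/
abbrev ringExtensionModule {R S : Type u} [Ring R] [Ring S] (l : R →+* S) : Module R S :=
  Module.compHom S l

/-- A ring extension `l : R →+* S` is a Frobenius extension if `S` is finitely generated
projective as a left `R`-module and `S` is isomorphic to `Hom_R(S, R)` as an `S`-`R`-bimodule.
The bimodule structure on `Hom_R(S, R)` is `(s • f • r) y = f (y * s) * r`. -/
structure IsFrobeniusExtension {R S : Type u} [Ring R] [Ring S] (l : R →+* S) : Prop where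
  finite : letI := ringExtensionModule l; Module.Finite R S
  projective : letI := ringExtensionModule l; Module.Projective R S
  exists_equiv : letI := ringExtensionModule l
    ∃ Φ : S ≃+ (S →ₗ[R] R),
      ∀ (s x : S) (r : R) (y : S), Φ (s * x * l r) y = Φ x (y * s) * r

/-- `S` is centrally projective over `R` if it is, as an `R`-`R`-bimodule, isomorphic to a direct
summand of `R^n` for some natural number `n`: there are homomorphisms of bimodules
`i : S → R^n` and `p : R^n → S` with `p ∘ i = id`. -/
def IsCentrallyProjective {R S : Type u} [Ring R] [Ring S] (l : R →+* S) : Prop :=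
  ∃ (n : ℕ) (i : S →+ (Fin n → R)) (p : (Fin n → R) →+ S),
    (∀ (r : R) (x : S) (r' : R), i (l r * x * l r') = fun k => r * i x k * r') ∧
    (∀ (r : R) (v : Fin n → R) (r' : R), p (fun k => r * v k * r') = l r * p v * l r') ∧
    ∀ x : S, p (i x) = x

open scoped TensorProduct in
/-- The relations `(s * l r) ⊗ m = s ⊗ (r • m)` cutting out `S ⊗_R M` from `S ⊗_ℤ M`. The set of
generators is stable under `S`, so the `S`-span is also the additive subgroup generated. -/
def inducedRel {R S : Type u} [Ring R] [Ring S] (l : R →+* S)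
    (M : Type u) [AddCommGroup M] [Module R M] : Submodule S (S ⊗[ℤ] M) :=
  Submodule.span S
    {t | ∃ (s : S) (r : R) (m : M), t = (s * l r) ⊗ₜ[ℤ] m - s ⊗ₜ[ℤ] (r • m)}

open scoped TensorProduct in
/-- The left `S`-module `S ⊗_R M` induced from the left `R`-module `M` along a homomorphism
`l : R →+* S` of (not necessarily commutative) rings; here `S` is a right `R`-module by
`s • r = s * l r`, and `S` acts by left multiplication on the first factor. -/
abbrev InducedModule {R S : Type u} [Ring R] [Ring S] (l : R →+* S)
    (M : Type u) [AddCommGroup M] [Module R M] : Type u :=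
  (S ⊗[ℤ] M) ⧸ inducedRel l M

/-- Vanishing of `Ext^i_R(M, N)` for all `i ≥ 1`. -/
def ExtVanish (R : Type u) [Ring R] (M N : Type u) [AddCommGroup M] [Module R M]
    [AddCommGroup N] [Module R N] : Prop :=
  ∀ i : ℕ, 1 ≤ i →
    Subsingleton (CategoryTheory.Abelian.Ext (ModuleCat.of R M) (ModuleCat.of R N) i)

/-- `ω` is a Wakamatsu tilting `R`-module. Put `T = End_R(ω)`. A right `T`-module, for the
convention where endomorphisms are written on the right of `ω`, is the same as a left module over
`Module.End R ω`, whose multiplication is composition of maps. The module `ω` is finitely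
generated over `R`, the bimodule `ω` is faithful and balanced, that is, `R → End_{T^op}(ω)` is an
isomorphism, and it is self-orthogonal on both sides. -/
structure IsWakamatsuTilting (R : Type u) [Ring R] (ω : Type u) [AddCommGroup ω] [Module R ω] :
    Prop where
  finite : Module.Finite R ω
  balanced : Function.Bijective
    (Module.toModuleEnd (Module.End R ω) ω : R →+* Module.End (Module.End R ω) ω)
  ext_left : ExtVanish R ω ω
  ext_right : ExtVanish (Module.End R ω) ω ω

/-- The evaluation map `σ : M → Hom_{T^op}(Hom_R(M, ω), ω)`, `σ m f = f m`, for `T = End_R(ω)`,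
which acts on `M^ω = Hom_R(M, ω)` by postcomposition. -/
def biDualEval (R : Type u) [Ring R] (ω M : Type u) [AddCommGroup ω] [Module R ω]
    [AddCommGroup M] [Module R M] :
    M →ₗ[R] ((M →ₗ[R] ω) →ₗ[Module.End R ω] ω) where
  toFun m :=
    { toFun := fun f => f m
      map_add' := fun _ _ => rfl
      map_smul' := fun _ _ => rfl }
  map_add' x y := by ext f; exact map_add f x y
  map_smul' r x := by ext f; exact map_smul f r x

/-- `M` is a (finitely generated) `R`-module of generalized G-dimension zero with respect to `ω`:
it is `ω`-reflexive, and `Ext^i_R(M, ω) = 0 = Ext^i_{T^op}(M^ω, ω)` for all `i ≥ 1`. -/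
structure IsGDimZero (R : Type u) [Ring R] (ω M : Type u) [AddCommGroup ω] [Module R ω]
    [AddCommGroup M] [Module R M] : Prop where
  finite : Module.Finite R M
  reflexive : Function.Bijective (biDualEval R ω M)
  ext_left : ExtVanish R M ω
  ext_right : ExtVanish (Module.End R ω) (M →ₗ[R] ω) ω

/-- There is an exact sequence `0 → G_n → ⋯ → G_1 → G_0 → M → 0` of `R`-modules in which
`G_0, …, G_n` have generalized G-dimension zero with respect to `ω`. The sequence is continued by
zero modules to the left. -/
def HasGResolution (R : Type u) [Ring R] (ω M : Type u) [AddCommGroup ω] [Module R ω]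
    [AddCommGroup M] [Module R M] (n : ℕ) : Prop :=
  ∃ (G : ℕ → ModuleCat.{u} R) (d : ∀ i, G (i + 1) →ₗ[R] G i) (ε : G 0 →ₗ[R] M),
    Function.Surjective ε ∧ Function.Exact (d 0) ε ∧
    (∀ i, Function.Exact (d (i + 1)) (d i)) ∧
    (∀ i, i ≤ n → IsGDimZero R ω (G i)) ∧ ∀ i, n < i → Subsingleton (G i)

/-- The generalized G-dimension of `M` with respect to `ω`: the infimum of the lengths `n` of
resolutions as above, and `⊤` if there is none. -/
noncomputable def gDim (R : Type u) [Ring R] (ω M : Type u) [AddCommGroup ω] [Module R ω]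
    [AddCommGroup M] [Module R M] : ℕ∞ :=
  ⨅ (n : ℕ) (_ : HasGResolution R ω M n), (n : ℕ∞)

/-!
Central projectivity of `S` over `R` alone carries the argument. It provides a finite dual basis
`x = ∑ c_k i_k(x)` of `S` in which the `c_k` commute with `R` and the `i_k : S → R` are
bimodule maps (`CentralDualBasis`). Hence `S ⊗_R M` is, as an `R`-module and naturally in `M`, a
direct summand of `M^n`, through the maps `m ↦ c_k ⊗ m` and `s ⊗ m ↦ i_k(s) m`. In particular
induction is exact, so it carries a resolution of `M` to one of `S ⊗_R M` of the same length, and it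
suffices that induction preserves modules of generalized G-dimension zero
(`IsGDimZero.inducedModule`).

Let `W = S ⊗_R ω`. Induction is exact and preserves projectives, so
`Ext_S(S ⊗_R G, X) = Ext_R(G, X)`, and this vanishes if `Ext_R(G, N)` does and the restriction of `X`
is a summand of a power of `N` (`ExtVanish.inducedModule`). With `N = ω` and `X = W` this is the
first Ext condition. For the second, the endomorphisms `s ⊗ w ↦ s c_k ⊗ w` show that `End_S(W)` is
again centrally projective over `End_R(ω)` (`CentralDualBasis.inducedEnd`), and the dual of
`S ⊗_R G` is the module induced from the dual of `G` along `End_R(ω) → End_S(W)`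
(`CentralDualBasis.inducedDualEquiv`); so the same lemma applies to this extension. Reflexivity is
checked on components with respect to the dual basis (`CentralDualBasis.biDualEval_bijective`).

The vanishing of Ext is handled by dimension shifting: it is the largest property of modules that
passes to syzygies and makes homomorphisms from syzygies extend (`extVanish_of_coinduction`).
-/

/-! ### Vanishing of Ext by dimension shifting -/

section ExtVanish

open CategoryTheory Abelian

variable {A : Type u} [Ring A]

/-- The short exact sequence of modules `0 → K → F → M → 0` as a short complex. -/
lemma moduleCat_shortExact {K F M : Type u} [AddCommGroup K] [Module A K] [AddCommGroup F]
    [Module A F] [AddCommGroup M] [Module A M] (f : K →ₗ[A] F) (g : F →ₗ[A] M)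
    (hf : Function.Injective f) (hfg : Function.Exact f g) (hg : Function.Surjective g) :
    (ShortComplex.mk (ModuleCat.ofHom f) (ModuleCat.ofHom g)
      (by ext x; exact hfg.apply_apply_eq_zero x)).ShortExact where
  exact := (ShortComplex.ShortExact.moduleCat_exact_iff_function_exact _).2 hfg
  mono_f := (ModuleCat.mono_iff_injective _).2 hf
  epi_g := (ModuleCat.epi_iff_surjective _).2 hg

/-- The vanishing of Ext passes to syzygies; with the extension property, this is the step that
`extVanish_of_coinduction` iterates. -/
lemma ExtVanish.exists_extension_and_extVanish {K F M N : Type u} [AddCommGroup K] [Module A K]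
    [AddCommGroup F] [Module A F] [AddCommGroup M] [Module A M] [AddCommGroup N] [Module A N]
    (h : ExtVanish A M N) [Module.Projective A F] (f : K →ₗ[A] F) (g : F →ₗ[A] M)
    (hf : Function.Injective f) (hfg : Function.Exact f g) (hg : Function.Surjective g) :
    (∀ a : K →ₗ[A] N, ∃ b : F →ₗ[A] N, b ∘ₗ f = a) ∧ ExtVanish A K N := by
  have hS := moduleCat_shortExact f g hf hfg hg
  have : Projective (ModuleCat.of A F) := (IsProjective.iff_projective F).1 inferInstance
  refine ⟨fun a => ?_, fun i hi => subsingleton_of_forall_eq 0 fun x => ?_⟩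
  · have := h 1 le_rfl
    obtain ⟨x, hx⟩ := Ext.contravariant_sequence_exact₁ hS (ModuleCat.of A N)
      (Ext.mk₀ (ModuleCat.ofHom a)) rfl (Subsingleton.elim (α := Ext _ _ _) _ _)
    obtain ⟨b, rfl⟩ := (Ext.mk₀_bijective _ _).2 x
    rw [Ext.mk₀_comp_mk₀] at hx
    exact ⟨b.hom, congrArg ModuleCat.Hom.hom ((Ext.mk₀_bijective _ _).1 hx)⟩
  · have := h (1 + i) (by lia)
    obtain ⟨y, rfl⟩ := Ext.contravariant_sequence_exact₁ hS (ModuleCat.of A N) x rfl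
      (Subsingleton.elim (α := Ext _ _ _) _ _)
    obtain ⟨j, rfl⟩ : ∃ j, i = j + 1 := ⟨i - 1, by lia⟩
    rw [Ext.eq_zero_of_projective y, Ext.comp_zero]

/-- Coinduction principle for the vanishing of Ext: a class `P` of modules consists of modules
without higher extensions by `N` as soon as each member is a quotient of a projective module such
that the kernel lies in `P` and homomorphisms from the kernel to `N` extend. -/
lemma extVanish_of_coinduction (N : Type u) [AddCommGroup N] [Module A N]
    (P : ∀ (M : Type u) [AddCommGroup M] [Module A M], Prop)
    (hP : ∀ (M : Type u) [AddCommGroup M] [Module A M], P M →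
      ∃ (K F : ModuleCat.{u} A) (f : K →ₗ[A] F) (g : F →ₗ[A] M), Module.Projective A F ∧
        Function.Injective f ∧ Function.Exact f g ∧ Function.Surjective g ∧ P K ∧
        ∀ a : K →ₗ[A] N, ∃ b : F →ₗ[A] N, b ∘ₗ f = a)
    (M : Type u) [AddCommGroup M] [Module A M] (hM : P M) : ExtVanish A M N := by
  suffices H : ∀ i (M : Type u) [AddCommGroup M] [Module A M], P M →
      Subsingleton (Ext (ModuleCat.of A M) (ModuleCat.of A N) (1 + i)) by
    intro i hi
    obtain ⟨j, rfl⟩ : ∃ j, i = 1 + j := ⟨i - 1, by lia⟩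
    exact H j M hM
  intro i
  induction i with
  | zero =>
    intro M _ _ hM
    obtain ⟨K, F, f, g, hF, hf, hfg, hg, -, hext⟩ := hP M hM
    have hS := moduleCat_shortExact f g hf hfg hg
    have : Projective (ModuleCat.of A F) := (IsProjective.iff_projective F).1 hF
    refine subsingleton_of_forall_eq 0 fun x => ?_
    obtain ⟨y, rfl⟩ := Ext.contravariant_sequence_exact₃ hS (ModuleCat.of A N) x
      (Ext.eq_zero_of_projective (n := 0) _) (n₀ := 0) rfl
    obtain ⟨a, rfl⟩ := (Ext.mk₀_bijective _ _).2 y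
    obtain ⟨b, hb⟩ := hext a.hom
    have hab : a = ModuleCat.ofHom f ≫ ModuleCat.ofHom b := by
      ext z; exact (LinearMap.congr_fun hb z).symm
    rw [hab, ← Ext.mk₀_comp_mk₀]
    exact hS.extClass_comp_assoc _
  | succ i ih =>
    intro M _ _ hM
    obtain ⟨K, F, f, g, hF, hf, hfg, hg, hK, -⟩ := hP M hM
    have hS := moduleCat_shortExact f g hf hfg hg
    have : Projective (ModuleCat.of A F) := (IsProjective.iff_projective F).1 hF
    have := ih K hK
    refine subsingleton_of_forall_eq 0 fun x => ?_
    obtain ⟨y, rfl⟩ := Ext.contravariant_sequence_exact₃ hS (ModuleCat.of A N) x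
      (Ext.eq_zero_of_projective (n := 1 + i) _) (n₀ := 1 + i) (add_comm _ _)
    rw [Subsingleton.elim (α := Ext _ _ _) y 0, Ext.comp_zero]

lemma ExtVanish.of_linearEquiv {M M' N : Type u} [AddCommGroup M] [Module A M]
    [AddCommGroup M'] [Module A M'] [AddCommGroup N] [Module A N] (e : M ≃ₗ[A] M')
    (h : ExtVanish A M N) : ExtVanish A M' N := fun i hi =>
  have : Subsingleton (((extFunctor i).obj (.op (ModuleCat.of A M))).obj (ModuleCat.of A N)) :=
    h i hi
  (((extFunctor i).mapIso e.toModuleIso.op).app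
    (ModuleCat.of A N)).addCommGroupIsoToAddEquiv.toEquiv.subsingleton

end ExtVanish

/-! ### Induced modules -/

namespace InducedModule

open scoped TensorProduct

variable {R S : Type u} [Ring R] [Ring S] {l : R →+* S}
variable {L M N X : Type u} [AddCommGroup L] [Module R L] [AddCommGroup M] [Module R M]
  [AddCommGroup N] [Module R N] [AddCommGroup X] [Module S X]

/-- The pure tensor `s ⊗ m` in `S ⊗_R M`. -/
def tmul (l : R →+* S) (s : S) (m : M) : InducedModule l M :=
  (inducedRel l M).mkQ (s ⊗ₜ[ℤ] m)

lemma tmul_add (s : S) (m m' : M) : tmul l s (m + m') = tmul l s m + tmul l s m' := by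
  simp [tmul, TensorProduct.tmul_add]

lemma smul_tmul (a s : S) (m : M) : a • tmul l s m = tmul l (a * s) m := by
  rw [tmul, tmul, ← map_smul, TensorProduct.smul_tmul', smul_eq_mul]

lemma tmul_smul (s : S) (r : R) (m : M) : tmul l s (r • m) = tmul l (s * l r) m := by
  have h : (s * l r) ⊗ₜ[ℤ] m - s ⊗ₜ[ℤ] (r • m) ∈ inducedRel l M :=
    Submodule.subset_span ⟨s, r, m, rfl⟩
  exact ((Submodule.Quotient.eq _).2 h).symm

@[elab_as_elim]
lemma induction_on {p : InducedModule l M → Prop} (x : InducedModule l M) (zero : p 0)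
    (tmul : ∀ s m, p (tmul l s m)) (add : ∀ x y, p x → p y → p (x + y)) : p x := by
  obtain ⟨t, rfl⟩ := (inducedRel l M).mkQ_surjective x
  induction t using TensorProduct.induction_on with
  | zero => simpa using zero
  | tmul s m => exact tmul s m
  | add x y hx hy => rw [map_add]; exact add _ _ hx hy

/-- The unit `m ↦ 1 ⊗ m` of the adjunction between induction and restriction of scalars. -/
def unit (l : R →+* S) (M : Type u) [AddCommGroup M] [Module R M] :
    M →ₛₗ[l] InducedModule l M where
  toFun m := tmul l 1 m
  map_add' := tmul_add 1
  map_smul' r m := by rw [tmul_smul, smul_tmul, one_mul, mul_one]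

lemma smul_unit (s : S) (m : M) : s • unit l M m = tmul l s m := by
  rw [unit, LinearMap.coe_mk, AddHom.coe_mk, smul_tmul, mul_one]

/-- The adjunction between induction and restriction of scalars: a semilinear map `M → X` extends
to an `S`-linear map `S ⊗_R M → X`. -/
def lift (f : M →ₛₗ[l] X) : InducedModule l M →ₗ[S] X :=
  (inducedRel l M).liftQ
    (TensorProduct.AlgebraTensorModule.lift
      (LinearMap.toSpanSingleton S (M →ₗ[ℤ] X) f.toAddMonoidHom.toIntLinearMap)) <| by
    rw [inducedRel, Submodule.span_le]
    rintro _ ⟨s, r, m, rfl⟩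
    simp [mul_smul]

@[simp]
lemma lift_tmul (f : M →ₛₗ[l] X) (s : S) (m : M) : lift f (tmul l s m) = s • f m := by
  simp [lift, tmul]

@[simp]
lemma lift_unit (f : M →ₛₗ[l] X) (m : M) : lift f (unit l M m) = f m := by
  rw [← one_smul S (unit l M m), smul_unit, lift_tmul, one_smul]

lemma hom_ext {f g : InducedModule l M →ₗ[S] X}
    (h : ∀ m, f (unit l M m) = g (unit l M m)) : f = g := by
  refine LinearMap.ext fun x => ?_
  induction x using induction_on with
  | zero => simp
  | tmul s m => rw [← smul_unit, map_smul, map_smul, h]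
  | add x y hx hy => rw [map_add, map_add, hx, hy]

/-- The map `1 ⊗ f : S ⊗_R M → S ⊗_R N` induced by an `R`-linear map `f : M → N`. -/
def map (l : R →+* S) (f : M →ₗ[R] N) : InducedModule l M →ₗ[S] InducedModule l N :=
  lift ((unit l N).comp f)

@[simp]
lemma map_tmul (f : M →ₗ[R] N) (s : S) (m : M) : map l f (tmul l s m) = tmul l s (f m) := by
  rw [map, lift_tmul, LinearMap.comp_apply, smul_unit]

@[simp]
lemma map_unit (f : M →ₗ[R] N) (m : M) : map l f (unit l M m) = unit l N (f m) :=
  map_tmul f 1 m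

lemma map_comp (g : M →ₗ[R] N) (f : L →ₗ[R] M) : map l (g ∘ₗ f) = map l g ∘ₗ map l f :=
  hom_ext fun m => by simp

lemma map_surjective {f : M →ₗ[R] N} (hf : Function.Surjective f) :
    Function.Surjective (map l f) := by
  intro x
  induction x using induction_on with
  | zero => exact ⟨0, map_zero _⟩
  | tmul s n =>
    obtain ⟨m, rfl⟩ := hf n
    exact ⟨tmul l s m, map_tmul f s m⟩
  | add x y hx hy =>
    obtain ⟨a, rfl⟩ := hx
    obtain ⟨b, rfl⟩ := hy
    exact ⟨a + b, map_add _ a b⟩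

instance [Subsingleton M] : Subsingleton (InducedModule l M) :=
  subsingleton_of_forall_eq 0 fun x => by
    induction x using induction_on with
    | zero => rfl
    | tmul s m => rw [Subsingleton.elim m 0, ← smul_unit, map_zero, smul_zero]
    | add x y hx hy => rw [hx, hy, add_zero]

instance [Module.Finite R M] : Module.Finite S (InducedModule l M) := by
  obtain ⟨s, hs⟩ := Module.Finite.fg_top (R := R) (M := M)
  classical
  refine ⟨s.image (unit l M), eq_top_iff.2 ?_⟩
  have key : ∀ m : M, unit l M m ∈ Submodule.span S (s.image (unit l M) : Set _) := by
    intro m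
    have hm : m ∈ Submodule.span R (s : Set M) := hs ▸ Submodule.mem_top
    induction hm using Submodule.span_induction with
    | mem x hx => exact Submodule.subset_span (by simpa using ⟨x, hx, rfl⟩)
    | zero => rw [map_zero]; exact zero_mem _
    | add x y _ _ hx hy => rw [map_add]; exact add_mem hx hy
    | smul r x _ hx => rw [map_smulₛₗ]; exact Submodule.smul_mem _ _ hx
  rintro x -
  induction x using induction_on with
  | zero => exact zero_mem _
  | tmul t m => rw [← smul_unit]; exact Submodule.smul_mem _ _ (key m)
  | add x y hx hy => exact add_mem hx hy

/-- Induction preserves projectivity, being left adjoint to an exact functor. -/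
instance [Module.Projective R M] : Module.Projective S (InducedModule l M) := by
  obtain ⟨σ, hσ⟩ := Module.Projective.out (R := R) (P := M)
  -- The section of `S^(M) → S ⊗_R M`, `m ↦ 1 ⊗ m`, extends that of `R^(M) → M`.
  let τ : (M →₀ R) →ₛₗ[l] (M →₀ S) :=
    { toFun := fun v => v.mapRange l (map_zero l)
      map_add' := fun v w => Finsupp.mapRange_add (map_add l) v w
      map_smul' := fun r v => by ext; simp }
  refine Module.Projective.of_split (lift (τ.comp σ)) (Finsupp.linearCombination S (unit l M)) ?_
  refine hom_ext fun m => ?_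
  have h : ∀ v : M →₀ R, Finsupp.linearCombination S (unit l M) (τ v) =
      unit l M (Finsupp.linearCombination R id v) := by
    intro v
    induction v using Finsupp.induction_linear with
    | zero => simp
    | add v w hv hw => rw [map_add, map_add, hv, hw, map_add, map_add]
    | single m r => simp [τ, Finsupp.mapRange_single, map_smulₛₗ]
  simpa [h] using congrArg (unit l M) (hσ m)

end InducedModule

/-! ### Centrally projective extensions -/

/-- A dual basis of `S` over `R` consisting of elements `c_k` of `S` that commute with the image of
`R` and of homomorphisms of bimodules `i_k : S → R` such that `x = ∑ c_k i_k(x)`. -/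
structure CentralDualBasis {R S : Type u} [Ring R] [Ring S] (l : R →+* S) (n : ℕ) where
  elt : Fin n → S
  coord : Fin n → S →+ R
  elt_mul : ∀ k r, elt k * l r = l r * elt k
  coord_mul : ∀ k r x r', coord k (l r * x * l r') = r * coord k x * r'
  sum_eq : ∀ x, ∑ k, elt k * l (coord k x) = x

lemma IsCentrallyProjective.exists_centralDualBasis {R S : Type u} [Ring R] [Ring S]
    {l : R →+* S} (h : IsCentrallyProjective l) : ∃ n, Nonempty (CentralDualBasis l n) := by
  obtain ⟨n, i, p, hi, hp, hpi⟩ := h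
  have right : ∀ k r, p (Pi.single k 1) * l r = p (Pi.single k r) := fun k r => by
    have := hp 1 (Pi.single k 1) r
    rw [map_one, one_mul] at this
    rw [← this]
    congr 1
    ext j
    by_cases hj : j = k
    · subst hj; simp
    · simp [hj]
  have left : ∀ k r, l r * p (Pi.single k 1) = p (Pi.single k r) := fun k r => by
    have := hp r (Pi.single k 1) 1
    rw [map_one, mul_one] at this
    rw [← this]
    congr 1
    ext j
    by_cases hj : j = k
    · subst hj; simp
    · simp [hj]
  exact ⟨n, ⟨{
    elt := fun k => p (Pi.single k 1)
    coord := fun k => (Pi.evalAddMonoidHom _ k).comp i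
    elt_mul := fun k r => by rw [right, left]
    coord_mul := fun k r x r' => congrFun (hi r x r') k
    sum_eq := fun x => by
      simp only [right]
      rw [← map_sum]
      conv_rhs => rw [← hpi x]
      exact congrArg p (Finset.univ_sum_single (i x)) }⟩⟩

namespace CentralDualBasis

open InducedModule
open scoped TensorProduct

variable {R S : Type u} [Ring R] [Ring S] {l : R →+* S} {n : ℕ} (b : CentralDualBasis l n)
variable {L M N : Type u} [AddCommGroup L] [Module R L] [AddCommGroup M] [Module R M]
  [AddCommGroup N] [Module R N]

lemma coord_mul_left (k : Fin n) (r : R) (x : S) : b.coord k (l r * x) = r * b.coord k x := by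
  simpa using b.coord_mul k r x 1

lemma coord_mul_right (k : Fin n) (x : S) (r : R) : b.coord k (x * l r) = b.coord k x * r := by
  simpa using b.coord_mul k 1 x r

/-- The semilinear map `m ↦ c_k ⊗ m` from `M` to `S ⊗_R M`. -/
def incl (M : Type u) [AddCommGroup M] [Module R M] (k : Fin n) : M →ₛₗ[l] InducedModule l M where
  toFun m := tmul l (b.elt k) m
  map_add' := tmul_add _
  map_smul' r m := by rw [tmul_smul, smul_tmul, b.elt_mul]

lemma incl_apply (k : Fin n) (m : M) : b.incl M k m = tmul l (b.elt k) m := rfl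

/-- The additive map `s ⊗ m ↦ i_k(s) m` on `S ⊗_ℤ M`, whose descent to `S ⊗_R M` is
`CentralDualBasis.proj`. -/
def preProj (M : Type u) [AddCommGroup M] [Module R M] (k : Fin n) : S ⊗[ℤ] M →+ M :=
  TensorProduct.liftAddHom
    ((AddMonoidHom.compHom.flip (b.coord k)).toFun (smulAddHom R M))
    fun z s m => by
      change b.coord k (z • s) • m = b.coord k s • z • m
      rw [map_zsmul, smul_assoc, smul_comm]

@[simp]
lemma preProj_tmul (k : Fin n) (s : S) (m : M) : b.preProj M k (s ⊗ₜ m) = b.coord k s • m := rfl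

/-- The additive map `s ⊗ m ↦ i_k(s) m` from `S ⊗_R M` to `M`. -/
def proj (M : Type u) [AddCommGroup M] [Module R M] (k : Fin n) : InducedModule l M →+ M :=
  QuotientAddGroup.lift (inducedRel l M).toAddSubgroup (b.preProj M k) <| by
    intro x hx
    -- The kernel of `preProj` is not an `S`-submodule, so all multiples are treated at once.
    have key : ∀ s : S, b.preProj M k (s • x) = 0 := by
      induction hx using Submodule.span_induction with
      | mem x hx =>
        obtain ⟨t, r, m, rfl⟩ := hx
        intro s
        simp [smul_sub, TensorProduct.smul_tmul', ← mul_assoc, coord_mul_right, mul_smul]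
      | zero => simp
      | add x y _ _ hx hy => intro s; rw [smul_add, map_add, hx, hy, add_zero]
      | smul a x _ hx => intro s; rw [smul_smul, hx]
    simpa using key 1

@[simp]
lemma proj_tmul (k : Fin n) (s : S) (m : M) : b.proj M k (tmul l s m) = b.coord k s • m := rfl

lemma proj_smul (k : Fin n) (r : R) (x : InducedModule l M) :
    b.proj M k (l r • x) = r • b.proj M k x := by
  induction x using induction_on with
  | zero => simp
  | tmul s m => rw [smul_tmul, proj_tmul, proj_tmul, coord_mul_left, mul_smul]
  | add x y hx hy => rw [smul_add, map_add, hx, hy, map_add, smul_add]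

/-- As a restricted module, `S ⊗_R M` is a direct summand of `M^n`. -/
lemma sum_incl_proj (x : InducedModule l M) : ∑ k, b.incl M k (b.proj M k x) = x := by
  induction x using induction_on with
  | zero => simp
  | tmul s m =>
    simp only [proj_tmul, incl_apply, tmul_smul]
    conv_rhs => rw [← b.sum_eq s, ← smul_unit, Finset.sum_smul]
    simp only [smul_unit]
  | add x y hx hy =>
    simp only [map_add, Finset.sum_add_distrib]
    rw [hx, hy]

lemma ext_proj {x y : InducedModule l M} (h : ∀ k, b.proj M k x = b.proj M k y) : x = y := by
  rw [← b.sum_incl_proj x, ← b.sum_incl_proj y]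
  simp only [h]

lemma map_incl (f : M →ₗ[R] N) (k : Fin n) (m : M) :
    map l f (b.incl M k m) = b.incl N k (f m) :=
  map_tmul f _ m

lemma proj_map (f : M →ₗ[R] N) (k : Fin n) (x : InducedModule l M) :
    b.proj N k (map l f x) = f (b.proj M k x) := by
  induction x using induction_on with
  | zero => simp
  | tmul s m => simp
  | add x y hx hy => simp only [map_add, hx, hy]

include b in
lemma map_injective {f : M →ₗ[R] N} (hf : Function.Injective f) :
    Function.Injective (map l f) := fun x y hxy =>
  b.ext_proj fun k => hf <| by rw [← b.proj_map, ← b.proj_map, hxy]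

include b in
/-- A centrally projective extension is flat. -/
lemma map_exact {f : L →ₗ[R] M} {g : M →ₗ[R] N} (h : Function.Exact f g) :
    Function.Exact (map l f) (map l g) := by
  intro x
  refine ⟨fun hx => ?_, ?_⟩
  · have : ∀ k, ∃ a, f a = b.proj M k x := fun k =>
      (h _).1 (by rw [← b.proj_map, hx, map_zero])
    choose a ha using this
    refine ⟨∑ k, b.incl L k (a k), ?_⟩
    rw [map_sum, ← b.sum_incl_proj x]
    simp only [map_incl, ha]
  · rintro ⟨y, rfl⟩
    refine b.ext_proj fun k => ?_
    rw [b.proj_map, b.proj_map, h.apply_apply_eq_zero, map_zero]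

/-- For an `R`-module `M` and a semilinear map from `M` to the restriction of `S ⊗_R N`, its `k`-th
component as a map `M → N`. -/
def component (k : Fin n) (f : M →ₛₗ[l] InducedModule l N) : M →ₗ[R] N where
  toFun m := b.proj N k (f m)
  map_add' x y := by rw [map_add, map_add]
  map_smul' r x := by rw [map_smulₛₗ, proj_smul, RingHom.id_apply]

@[simp]
lemma component_apply (k : Fin n) (f : M →ₛₗ[l] InducedModule l N) (m : M) :
    b.component k f m = b.proj N k (f m) := rfl

end CentralDualBasis

/-! ### Ext of induced modules -/

section ExtInduced

open InducedModule

variable {R S : Type u} [Ring R] [Ring S] {l : R →+* S} {n : ℕ}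

/-- Vanishing of `Ext_R(G, N)` passes to `Ext_S(S ⊗_R G, X)` for every `S`-module `X` whose
restriction to `R` is a direct summand of `N^n`, as `Ext_S(S ⊗_R G, X) = Ext_R(G, X)`. The direct
summand is given by maps `γ_k : N → X` and `π_k : X → N` such that `∑ γ_k π_k = 1`. -/
lemma ExtVanish.inducedModule (b : CentralDualBasis l n) {G N X : Type u} [AddCommGroup G]
    [Module R G] [AddCommGroup N] [Module R N] [AddCommGroup X] [Module S X]
    (γ : Fin n → N →ₛₗ[l] X) (π : Fin n → X →+ N)
    (hπ : ∀ k r x, π k (l r • x) = r • π k x) (hγπ : ∀ x, ∑ k, γ k (π k x) = x)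
    (h : ExtVanish R G N) : ExtVanish S (InducedModule l G) X := by
  refine extVanish_of_coinduction X (fun Y _ _ => ∃ G : ModuleCat.{u} R,
    Nonempty (InducedModule l G ≃ₗ[S] Y) ∧ ExtVanish R G N) ?_ (InducedModule l G)
    ⟨ModuleCat.of R G, ⟨LinearEquiv.refl S _⟩, h⟩
  rintro Y _ _ ⟨G, ⟨e⟩, hG⟩
  let g : (G →₀ R) →ₗ[R] G := Finsupp.linearCombination R id
  have hg : Function.Surjective g := Finsupp.linearCombination_id_surjective R G
  let f : LinearMap.ker g →ₗ[R] (G →₀ R) := (LinearMap.ker g).subtype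
  have hf : Function.Injective f := Subtype.val_injective
  have hfg : Function.Exact f g := LinearMap.exact_subtype_ker_map g
  obtain ⟨hext, hK⟩ :=
    ExtVanish.exists_extension_and_extVanish (K := LinearMap.ker g) (F := G →₀ R) hG f g hf hfg hg
  refine ⟨ModuleCat.of S (InducedModule l (LinearMap.ker g)),
    ModuleCat.of S (InducedModule l (G →₀ R)), map l f, e.toLinearMap ∘ₗ map l g,
    inferInstanceAs (Module.Projective S (InducedModule l (G →₀ R))), b.map_injective hf, ?_,
    e.surjective.comp (map_surjective hg),
    ⟨ModuleCat.of R (LinearMap.ker g), ⟨LinearEquiv.refl S _⟩, hK⟩, fun a => ?_⟩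
  · intro x
    rw [LinearMap.comp_apply, LinearEquiv.coe_coe, e.map_eq_zero_iff]
    exact b.map_exact hfg x
  · -- Extend the components `π_k ∘ a` of `a : K → X` over `R`, then recombine them.
    let a' (k : Fin n) : LinearMap.ker g →ₗ[R] N :=
      { toFun := fun x => π k (a (unit l _ x))
        map_add' := fun x y => by rw [map_add, map_add, map_add]
        map_smul' := fun r x => by rw [map_smulₛₗ, map_smul, hπ, RingHom.id_apply] }
    choose c hc using fun k => hext (a' k)
    refine ⟨lift (∑ k, (γ k).comp (c k)), hom_ext fun x => ?_⟩
    have hc' : ∀ k, c k (f x) = π k (a (unit l _ x)) := fun k => LinearMap.congr_fun (hc k) x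
    rw [LinearMap.comp_apply, map_unit, lift_unit, LinearMap.sum_apply]
    simp only [LinearMap.comp_apply, hc']
    exact hγπ _

end ExtInduced

/-! ### Endomorphisms and duals of induced modules -/

section Endomorphisms

open InducedModule

variable {R S : Type u} [Ring R] [Ring S] (l : R →+* S) {n : ℕ}
variable (ω G : Type u) [AddCommGroup ω] [Module R ω] [AddCommGroup G] [Module R G]

/-- The ring homomorphism `End_R(ω) → End_S(S ⊗_R ω)`, `t ↦ 1 ⊗ t`. -/
def inducedEnd : Module.End R ω →+* Module.End S (InducedModule l ω) where
  toFun t := map l t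
  map_one' := hom_ext fun m => by simp
  map_mul' s t := map_comp s t
  map_zero' := hom_ext fun m => by simp
  map_add' s t := hom_ext fun m => by simp

lemma inducedEnd_apply (t : Module.End R ω) : inducedEnd l ω t = map l t := rfl

/-- The map `f ↦ 1 ⊗ f` between the `ω`-dual of `G` and the `S ⊗_R ω`-dual of `S ⊗_R G`, which is
semilinear over the endomorphism rings. -/
def dualMap : (G →ₗ[R] ω) →ₛₗ[inducedEnd l ω] (InducedModule l G →ₗ[S] InducedModule l ω) where
  toFun f := map l f
  map_add' f g := hom_ext fun m => by simp
  map_smul' t f := map_comp t f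

lemma dualMap_apply (f : G →ₗ[R] ω) : dualMap l ω G f = map l f := rfl

variable {l}

/-- If `S` is centrally projective over `R`, then so is `End_S(S ⊗_R ω)` over `End_R(ω)`: the
endomorphism `s ⊗ w ↦ s c_k ⊗ w` commutes with `1 ⊗ t` for all `t`. -/
def CentralDualBasis.inducedEnd (b : CentralDualBasis l n) :
    CentralDualBasis (inducedEnd l ω) n where
  elt k := lift (b.incl ω k)
  coord k :=
    { toFun := fun e => b.component k (e.comp (unit l ω))
      map_zero' := by ext; simp
      map_add' := fun e e' => by ext; simp }
  elt_mul k t := hom_ext fun m => by simp [inducedEnd_apply, b.map_incl]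
  coord_mul k t e t' := by
    ext m
    simp [inducedEnd_apply, b.proj_map]
  sum_eq e := hom_ext fun m => by
    simp [inducedEnd_apply, LinearMap.sum_apply, b.sum_incl_proj]

/-- The `k`-th inclusion of `ω` into the restriction of `S ⊗_R ω`, as a map that is semilinear over
the endomorphism rings. -/
def CentralDualBasis.inclEnd (b : CentralDualBasis l n) (k : Fin n) :
    ω →ₛₗ[_root_.inducedEnd l ω] InducedModule l ω where
  toFun := b.incl ω k
  map_add' := map_add _
  map_smul' t w := (b.map_incl t k w).symm

variable {ω G}

lemma CentralDualBasis.dual_eq_sum (b : CentralDualBasis l n)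
    (f : InducedModule l G →ₗ[S] InducedModule l ω) :
    ∑ k, (b.inducedEnd ω).elt k • dualMap l ω G (b.component k (f.comp (unit l G))) = f :=
  hom_ext fun m => by
    simp [LinearMap.sum_apply, dualMap_apply, CentralDualBasis.inducedEnd, b.sum_incl_proj]

lemma CentralDualBasis.proj_lift_dualMap (b : CentralDualBasis l n) (k : Fin n)
    (x : InducedModule (_root_.inducedEnd l ω) (G →ₗ[R] ω)) :
    (b.inducedEnd ω).proj (G →ₗ[R] ω) k x =
      b.component k ((lift (dualMap l ω G) x).comp (unit l G)) := by
  induction x using induction_on with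
  | zero => ext; simp
  | tmul e f => ext m; simp [dualMap_apply, CentralDualBasis.inducedEnd]
  | add x y hx hy =>
    rw [map_add, hx, hy]
    ext m
    simp

/-- The `S ⊗_R ω`-dual of `S ⊗_R G` is induced from the `ω`-dual of `G` along
`End_R(ω) → End_S(S ⊗_R ω)`. -/
noncomputable def CentralDualBasis.inducedDualEquiv (b : CentralDualBasis l n) :
    InducedModule (_root_.inducedEnd l ω) (G →ₗ[R] ω) ≃ₗ[Module.End S (InducedModule l ω)]
      (InducedModule l G →ₗ[S] InducedModule l ω) :=
  LinearEquiv.ofBijective (lift (dualMap l ω G)) <| by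
    refine ⟨fun x y hxy => (b.inducedEnd ω).ext_proj fun k => ?_, fun f => ?_⟩
    · rw [b.proj_lift_dualMap k x, b.proj_lift_dualMap k y, hxy]
    · refine ⟨∑ k, tmul (_root_.inducedEnd l ω) ((b.inducedEnd ω).elt k)
        (b.component k (f.comp (unit l G))), ?_⟩
      simp only [map_sum, lift_tmul, b.dual_eq_sum]

lemma CentralDualBasis.biDualEval_bijective (b : CentralDualBasis l n)
    (h : Function.Bijective (biDualEval R ω G)) :
    Function.Bijective (biDualEval S (InducedModule l ω) (InducedModule l G)) := by
  refine ⟨fun x y hxy => b.ext_proj fun k => h.1 ?_, fun ψ => ?_⟩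
  · ext f
    have := congrArg (b.proj ω k) (LinearMap.congr_fun hxy (dualMap l ω G f))
    change b.proj ω k (map l f x) = b.proj ω k (map l f y) at this
    rwa [b.proj_map, b.proj_map] at this
  · -- The components of `ψ` on the dual of `G` are evaluations at some `g_k`, and `ψ` is the
    -- evaluation at `∑ c_k ⊗ g_k`.
    let ψ' (k : Fin n) : (G →ₗ[R] ω) →ₗ[Module.End R ω] ω :=
      { toFun := fun f => b.proj ω k (ψ (dualMap l ω G f))
        map_add' := fun f g => by rw [map_add, map_add, map_add]
        map_smul' := fun t f => by
          rw [map_smulₛₗ, map_smul]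
          exact b.proj_map t k _ }
    choose g hg using fun k => h.2 (ψ' k)
    have hg' : ∀ k f, f (g k) = b.proj ω k (ψ (dualMap l ω G f)) := fun k f =>
      LinearMap.congr_fun (hg k) f
    obtain ⟨x, hx⟩ : ∃ x, ∀ f, map l f x = ψ (dualMap l ω G f) :=
      ⟨∑ k, b.incl G k (g k), fun f => by simp only [map_sum, b.map_incl, hg', b.sum_incl_proj]⟩
    refine ⟨x, LinearMap.ext fun f => ?_⟩
    rw [← b.dual_eq_sum f, map_sum, map_sum]
    simp only [map_smul, ← hx]
    rfl

end Endomorphisms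

/-! ### Generalized G-dimension -/

section GDimension

open InducedModule

variable {R S : Type u} [Ring R] [Ring S] {l : R →+* S} {n : ℕ}
variable {ω G : Type u} [AddCommGroup ω] [Module R ω] [AddCommGroup G] [Module R G]

lemma IsGDimZero.inducedModule (b : CentralDualBasis l n) (h : IsGDimZero R ω G) :
    IsGDimZero S (InducedModule l ω) (InducedModule l G) where
  finite := have := h.finite; inferInstance
  reflexive := b.biDualEval_bijective h.reflexive
  ext_left := h.ext_left.inducedModule b (b.incl ω) (b.proj ω) b.proj_smul b.sum_incl_proj
  ext_right := (h.ext_right.inducedModule (b.inducedEnd ω) (b.inclEnd ω) (b.proj ω)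
    (fun k t x => b.proj_map t k x) b.sum_incl_proj).of_linearEquiv b.inducedDualEquiv

lemma HasGResolution.inducedModule (b : CentralDualBasis l n) {m : ℕ}
    (h : HasGResolution R ω G m) :
    HasGResolution S (InducedModule l ω) (InducedModule l G) m := by
  obtain ⟨F, d, ε, hε, hdε, hd, hF, h0⟩ := h
  exact ⟨fun i => ModuleCat.of S (InducedModule l (F i)), fun i => map l (d i), map l ε,
    map_surjective hε, b.map_exact hdε, fun i => b.map_exact (hd i),
    fun i hi => (hF i hi).inducedModule b,
    fun i hi => have := h0 i hi; inferInstanceAs (Subsingleton (InducedModule l (F i)))⟩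

end GDimension

theorem proposition5p10 {R S : Type u} [Ring R] [Ring S]
    [IsNoetherianRing R] [IsNoetherianRing Rᵐᵒᵖ] [IsNoetherianRing S] [IsNoetherianRing Sᵐᵒᵖ]
    (l : R →+* S) (hF : IsFrobeniusExtension l) (hC : IsCentrallyProjective l)
    (ω : Type u) [AddCommGroup ω] [Module R ω] (hω : IsWakamatsuTilting R ω)
    (M : Type u) [AddCommGroup M] [Module R M] [Module.Finite R M] :
    gDim S (InducedModule l ω) (InducedModule l M) ≤ gDim R ω M := by
  obtain ⟨n, ⟨b⟩⟩ := hC.exists_centralDualBasis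
  exact iInf_mono fun m => iInf_mono' fun h => ⟨h.inducedModule b, le_rfl⟩
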